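/- Let $k$ be a field and let $\mathbb{R}^2$ carry the product partial order. An $\mathbb{R}^2$-indexed module is a functor $M$ from $\mathbb{R}^2$ to the category of $k$-vector spaces; it is p.f.d. if every $M_a$ is finite dimensional. An interval of $\mathbb{R}^2$ is a non-empty, convex, connected subset $\mathcal J$ (connected through chains of pairwise comparable elements of $\mathcal J$); the interval module $I^{\mathcal J}$ is $k$ at the points of $\mathcal J$ and $0$ elsewhere, with identity maps between points $a\le b$ of $\mathcal J$ and zero maps otherwise. If $M\cong\bigoplus_{\mathcal J\in\mathcal B(M)} I^{\mathcal J}$ for a (possibly infinite) multiset $\mathcal B(M)$ of intervals, then $\mathcal B(M)$ is called the barcode of $M$ (it is unique). The module $M$ is free if $M\cong\bigoplus_{a\in\xi} I^{\langle a\rangle}$ for a multiset $\xi$ of points of $\mathbb{R}^2$, where $\langle a\rangle=\{b\in\mathbb{R}^2 : a\le b\}$. For $\epsilon\ge 0$ let $M(\epsilon)_a=M_{a+(\epsilon,\epsilon)}$, with the obvious internal maps. Modules $M,N$ are $\epsilon$-interleaved if there are morphisms $f:M\to N(\epsilon)$ and $g:N\to M(\epsilon)$ such that, for all $a\in\mathbb{R}^2$,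 $g_{a+(\epsilon,\epsilon)}\circ f_a$ is the internal map $M_a\to M_{a+(2\epsilon,2\epsilon)}$ and $f_{a+(\epsilon,\epsilon)}\circ g_a$ is the internal map $N_a\to N_{a+(2\epsilon,2\epsilon)}$; $M$ is $\epsilon$-trivial if all internal maps $M_a\to M_{a+(\epsilon,\epsilon)}$ are zero. An $\epsilon$-matching between multisets of intervals $\mathcal C,\mathcal D$ is a bijection $\sigma$ from a sub-multiset of $\mathcal C$ to a sub-multiset of $\mathcal D$ such that every interval $\mathcal J$ of $\mathcal C$ or $\mathcal D$ for which $I^{\mathcal J}$ is not $2\epsilon$-trivial is matched, and whenever $\sigma(\mathcal J)=\mathcal K$, the modules $I^{\mathcal J}$ and $I^{\mathcal K}$ are $\epsilon$-interleaved. Put $$d_I(M,N)=\inf\{\epsilon\ge 0 : M,N\text{ are }\epsilon\text{-interleaved}\},\qquad d_b(\mathcal C,\mathcal D)=\inf\{\epsilon\ge 0 : \text{there is an }\epsilon\text{-matching between }\mathcal C\text{ and }\mathcal D\},$$ with $\inf\emptyset=\infty$. **Isometry theorem for free $\mathbb{R}^2$-indexed modules.** Let $M$ and $N$ be p.f.d.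 free $\mathbb{R}^2$-indexed modules. For every $\epsilon\ge 0$, $M$ and $N$ are $\epsilon$-interleaved if and only if there exists an $\epsilon$-matching between $\mathcal B(M)$ and $\mathcal B(N)$. In particular, $d_I(M,N)=d_b(\mathcal B(M),\mathcal B(N))$. -/

import Mathlib

open CategoryTheory
open scoped NNReal ENNReal DirectSum

universe u

noncomputable section

namespace Persistence

/-- An interval of a poset: a nonempty, convex and connected subset. -/
structure Interval (P : Type) [PartialOrder P] where
  carrier : Set P
  nonempty : carrier.Nonempty
  convex : ∀ a ∈ carrier, ∀ c ∈ carrier, ∀ b, a ≤ b → b ≤ c → b ∈ carrier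
  connected : ∀ a ∈ carrier, ∀ c ∈ carrier,
    Relation.ReflTransGen
      (fun x y => x ∈ carrier ∧ y ∈ carrier ∧ (x ≤ y ∨ y ≤ x)) a c

/-- A `P`-indexed persistence module over the field `k`: a functor from the poset `P` to
`k`-vector spaces. -/
abbrev PersMod (k : Type u) [Field k] (P : Type) [PartialOrder P] : Type (u + 1) :=
  P ⥤ ModuleCat.{u} k

section Modules

variable (k : Type u) [Field k] {P : Type} [PartialOrder P]

/-- The value of the interval module at `a`, as a subspace of `k`: all of `k` if `a` lies in the
interval, and `0` otherwise. -/
def intervalSpace (J : Interval P) (a : P) : Submodule k k where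
  carrier := {x | a ∉ J.carrier → x = 0}
  add_mem' := fun hx hy h => by rw [hx h, hy h, add_zero]
  zero_mem' := fun _ => rfl
  smul_mem' := fun c x hx h => by rw [hx h, smul_zero]

open Classical in
/-- The structure maps of the interval module: the identity of `k` if both points lie in the
interval, and `0` otherwise. -/
def intervalMap (J : Interval P) (a b : P) : intervalSpace k J a →ₗ[k] intervalSpace k J b where
  toFun x := ⟨if a ∈ J.carrier ∧ b ∈ J.carrier then (x : k) else 0,
    fun h => if_neg fun h' => h h'.2⟩
  map_add' x y := by
    apply Subtype.ext
    by_cases h : a ∈ J.carrier ∧ b ∈ J.carrier <;> simp [h]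
  map_smul' c x := by
    apply Subtype.ext
    by_cases h : a ∈ J.carrier ∧ b ∈ J.carrier <;> simp [h]

/-- The interval module `I^J`. -/
def intervalModule (J : Interval P) : PersMod k P where
  obj a := ModuleCat.of k (intervalSpace k J a)
  map {a b} _ := ModuleCat.ofHom (intervalMap k J a b)
  map_id a := by
    ext1
    refine LinearMap.ext fun x => Subtype.ext ?_
    by_cases h : a ∈ J.carrier
    · simp [intervalMap, h]
    · have hx : x.1 = 0 := x.2 h
      simp [intervalMap, h, hx]
  map_comp {a b c} f g := by
    ext1
    refine LinearMap.ext fun x => Subtype.ext ?_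
    by_cases ha : a ∈ J.carrier
    · by_cases hc : c ∈ J.carrier
      · have hb : b ∈ J.carrier := J.convex a ha c hc b (leOfHom f) (leOfHom g)
        simp [intervalMap, ha, hb, hc]
      · simp [intervalMap, hc]
    · simp [intervalMap, ha]

variable {k}

/-- The direct sum of a family of persistence modules, formed pointwise. -/
def directSum {ι : Type u} (M : ι → PersMod k P) : PersMod k P where
  obj a := ModuleCat.of k (⨁ i, (M i).obj a)
  map f := ModuleCat.ofHom (DirectSum.lmap fun i => ((M i).map f).hom)
  map_id a := by
    ext1
    simp
  map_comp f g := by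
    ext1
    simp

/-- `M` is pointwise finite dimensional. -/
def IsPFD (M : PersMod k P) : Prop :=
  ∀ a, FiniteDimensional k (M.obj a)

end Modules

/-- A barcode over `P`, i.e. a (possibly infinite) multiset of intervals of `P`, given as a family:
an interval occurs once for each index mapping to it. -/
structure Barcode (P : Type) [PartialOrder P] : Type (u + 1) where
  ι : Type u
  interval : ι → Interval P

/-- `C` is the barcode `B(M)` of `M`, i.e. `M` is isomorphic to the direct sum of the interval
modules of the members of `C`. -/
def IsBarcode {k : Type u} [Field k] {P : Type} [PartialOrder P] (M : PersMod k P)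
    (C : Barcode.{u} P) : Prop :=
  Nonempty (M ≅ directSum fun i => intervalModule k (C.interval i))

/-- The interval `⟨a⟩ = {b | a ≤ b}`. -/
def principal {P : Type} [PartialOrder P] (a : P) : Interval P where
  carrier := {b | a ≤ b}
  nonempty := ⟨a, le_rfl⟩
  convex := fun _ hx _ _ _ hxy _ => le_trans hx hxy
  connected := fun _ hx _ hy =>
    Relation.ReflTransGen.trans (b := a)
      (Relation.ReflTransGen.single ⟨hx, le_refl a, Or.inr hx⟩)
      (Relation.ReflTransGen.single ⟨le_refl a, hy, Or.inl hy⟩)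

/-- `F` is free: it is a direct sum of modules `I^⟨a⟩`, for `a` ranging over a multiset. -/
def IsFree {k : Type u} [Field k] {P : Type} [PartialOrder P] (F : PersMod k P) : Prop :=
  ∃ (ι : Type u) (ξ : ι → P),
    Nonempty (F ≅ directSum fun i => intervalModule k (principal (ξ i)))

/-! Interleavings and matchings, for functors on `ℝ²`. -/

/-- The poset `ℝ²`. (It is a structure of its own because `ℝ × ℝ` also carries, as a product of two
categories, a category structure that is different in Lean from the one given by its order.) -/
@[ext]
structure Plane where
  x : ℝ
  y : ℝ

/-- The product order on the plane. -/
instance : PartialOrder Plane where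
  le a b := a.x ≤ b.x ∧ a.y ≤ b.y
  le_refl _ := ⟨le_rfl, le_rfl⟩
  le_trans _ _ _ h h' := ⟨h.1.trans h'.1, h.2.trans h'.2⟩
  le_antisymm _ _ h h' := Plane.ext (le_antisymm h.1 h'.1) (le_antisymm h.2 h'.2)

/-- The translation `a ↦ a + (ε, ε)` of the plane. -/
def translate (ε : ℝ≥0) (a : Plane) : Plane := ⟨a.x + ε, a.y + ε⟩

theorem translate_mono (ε : ℝ≥0) : Monotone (translate ε) :=
  fun _ _ h => ⟨add_le_add_left h.1 _, add_le_add_left h.2 _⟩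

theorem le_translate (ε : ℝ≥0) (a : Plane) : a ≤ translate ε a :=
  ⟨le_add_of_nonneg_right ε.2, le_add_of_nonneg_right ε.2⟩

section Interleaving

variable {C : Type*} [Category C]

/-- The shift `M(ε)`, with `M(ε)_a = M_{a + (ε, ε)}`. -/
def shift (ε : ℝ≥0) (M : Plane ⥤ C) : Plane ⥤ C :=
  (translate_mono ε).functor ⋙ M

/-- The functors `M` and `N` are `ε`-interleaved: there are `f : M → N(ε)` and `g : N → M(ε)` such
that `g(ε) ∘ f` and `f(ε) ∘ g` are given by the internal maps from `a` to `a + 2(ε, ε)`. -/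
def IsInterleaved (ε : ℝ≥0) (M N : Plane ⥤ C) : Prop :=
  ∃ (f : M ⟶ shift ε N) (g : N ⟶ shift ε M),
    (∀ a, f.app a ≫ g.app (translate ε a) =
      M.map (homOfLE ((le_translate ε a).trans (le_translate ε (translate ε a))))) ∧
    (∀ a, g.app a ≫ f.app (translate ε a) =
      N.map (homOfLE ((le_translate ε a).trans (le_translate ε (translate ε a)))))

/-- The interleaving distance; the infimum of the empty set is `∞`. -/
def interleavingDist (M N : Plane ⥤ C) : ℝ≥0∞ :=
  ⨅ (ε : ℝ≥0) (_ : IsInterleaved ε M N), (ε : ℝ≥0∞)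

end Interleaving

section Matching

variable (k : Type u) [Field k]

/-- `M` is `ε`-trivial: all internal maps `M_a → M_{a + (ε, ε)}` vanish. -/
def IsTrivial {k : Type u} [Field k] (ε : ℝ≥0) (M : PersMod k Plane) : Prop :=
  ∀ a, M.map (homOfLE (le_translate ε a)) = 0

/-- A matching between barcodes is a partial bijection of their index sets. It is an `ε`-matching if
it matches all intervals that are not `2ε`-trivial, and matched intervals are `ε`-interleaved. -/
def IsMatching (ε : ℝ≥0) (C D : Barcode.{u} Plane) (σ : C.ι ≃. D.ι) : Prop :=
  (∀ i, ¬ IsTrivial (2 * ε) (intervalModule k (C.interval i)) → ∃ j, j ∈ σ i) ∧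
  (∀ j, ¬ IsTrivial (2 * ε) (intervalModule k (D.interval j)) → ∃ i, j ∈ σ i) ∧
  (∀ i j, j ∈ σ i →
    IsInterleaved ε (intervalModule k (C.interval i)) (intervalModule k (D.interval j)))

/-- The bottleneck distance; the infimum of the empty set is `∞`. -/
def bottleneckDist (C D : Barcode.{u} Plane) : ℝ≥0∞ :=
  ⨅ (ε : ℝ≥0) (_ : ∃ σ : C.ι ≃. D.ι, IsMatching k ε C D σ), (ε : ℝ≥0∞)

end Matching

end Persistence

end

noncomputable section

namespace Persistence

/-! ### Coordinates and generators of direct sums of interval modules. -/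

section IntervalSum

variable {k : Type u} [Field k] {P : Type} [PartialOrder P] {ι : Type u}

/-! Every interval decomposition of a free module consists of principal intervals
(`exists_eq_principal`), so each module is described by its family of generators. Principal modules
are never trivial, hence an ε-matching is a bijection.

An interleaving gives matrices `F`, `G` on generators with `G F = 1`, because internal maps of free
modules lose no coordinate. A nonzero `F b a` only says `b ≤ a + ε`, and a nonzero `G c b` only says
`c ≤ b + ε`. But if `a` has coordinate sum at most that of `c`, then one of `a`, `c` is ε-close to
`b` (`close_or_close`). So the entries `(c, a)` of `G F` with `a` at most `c` in this order only see
neighbours of `a` or `c`, which suffices for Hall's condition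
(`exists_injective_rel_of_mul_eq_one`). This gives closeness-respecting injections both ways, and
Schröder–Bernstein merges them.

Conversely, ε-close generators give inclusions of principal modules into shifts, and these are
summed. -/

/-- The direct sum of the interval modules of a family of intervals. -/
abbrev intervalSum (k : Type u) [Field k] (J : ι → Interval P) : PersMod k P :=
  directSum fun i => intervalModule k (J i)

/-- The `i`-th coordinate of a vector of a direct sum of interval modules, as a scalar. -/
def coeff (J : ι → Interval P) (i : ι) (a : P) : (intervalSum k J).obj a →ₗ[k] k :=
  (intervalSpace k (J i) a).subtype ∘ₗ
    DirectSum.component k ι (fun i => intervalSpace k (J i) a) i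

open Classical in
/-- The standard generator of the `i`-th summand at `a`, which is `0` outside the `i`-th
interval. -/
def gen (k : Type u) [Field k] (J : ι → Interval P) (i : ι) (a : P) : (intervalSum k J).obj a :=
  DirectSum.lof k ι (fun i => intervalSpace k (J i) a) i
    ⟨if a ∈ (J i).carrier then 1 else 0, fun h => if_neg h⟩

variable (J : ι → Interval P)

theorem coeff_ext {a : P} {x y : (intervalSum k J).obj a}
    (h : ∀ i, coeff J i a x = coeff J i a y) : x = y :=
  DirectSum.ext_component k fun i => Subtype.ext (h i)

open Classical in
theorem coeff_gen (i j : ι) (a : P) :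
    coeff J j a (gen k J i a) = if i = j ∧ a ∈ (J i).carrier then 1 else 0 := by
  have h1 : coeff J j a (gen k J i a) = (DirectSum.component k ι
      (fun i => intervalSpace k (J i) a) j (DirectSum.lof k ι (fun i => intervalSpace k (J i) a) i
        ⟨if a ∈ (J i).carrier then 1 else 0, fun h => if_neg h⟩)).1 := rfl
  by_cases h : i = j
  · subst h
    rw [h1, DirectSum.component.lof_self]
    simp
  · rw [h1, DirectSum.component.of, dif_neg h]
    simp [h]

theorem coeff_gen_self {i : ι} {a : P} (h : a ∈ (J i).carrier) :
    coeff J i a (gen k J i a) = 1 := by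
  classical
  rw [coeff_gen, if_pos ⟨rfl, h⟩]

open Classical in
theorem coeff_map {a b : P} (f : a ⟶ b) (i : ι) (x : (intervalSum k J).obj a) :
    coeff J i b ((intervalSum k J).map f x) =
      if a ∈ (J i).carrier ∧ b ∈ (J i).carrier then coeff J i a x else 0 :=
  rfl

theorem coeff_eq_zero {a : P} {i : ι} (h : a ∉ (J i).carrier) (x : (intervalSum k J).obj a) :
    coeff J i a x = 0 :=
  (DirectSum.component k ι (fun i => intervalSpace k (J i) a) i x).2 h

theorem mem_of_coeff_ne_zero {a : P} {i : ι} {x : (intervalSum k J).obj a}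
    (h : coeff J i a x ≠ 0) : a ∈ (J i).carrier :=
  not_not.1 fun h' => h (coeff_eq_zero J h' x)

theorem finite_coeff_ne_zero {a : P} (x : (intervalSum k J).obj a) :
    {i | coeff J i a x ≠ 0}.Finite := by
  classical
  let y : ⨁ i, intervalSpace k (J i) a := x
  refine (DFinsupp.support y).finite_toSet.subset fun i hi => ?_
  rw [Finset.mem_coe, DFinsupp.mem_support_toFun]
  intro h
  exact hi (congrArg Subtype.val h)

theorem eq_sum_coeff_smul_gen {a : P} (x : (intervalSum k J).obj a) {s : Finset ι}
    (hs : ∀ i, coeff J i a x ≠ 0 → i ∈ s) : x = ∑ i ∈ s, coeff J i a x • gen k J i a := by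
  classical
  refine coeff_ext J fun j => ?_
  simp only [map_sum, map_smul, coeff_gen, smul_eq_mul]
  by_cases hj : coeff J j a x = 0
  · rw [hj, Finset.sum_eq_zero]
    intro i _
    by_cases h : i = j <;> simp [h, hj]
  · rw [Finset.sum_eq_single_of_mem j (hs j hj)]
    · simp [mem_of_coeff_ne_zero J hj]
    · intro i _ h
      simp [h]

theorem map_gen {a b : P} (f : a ⟶ b) {i : ι} (ha : a ∈ (J i).carrier) :
    (intervalSum k J).map f (gen k J i a) = gen k J i b := by
  classical
  refine coeff_ext J fun j => ?_
  rw [coeff_map, coeff_gen, coeff_gen]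
  by_cases h : i = j
  · subst h
    simp [ha]
  · simp [h]

/-- The generators living at `a` are linearly independent. This turns pointwise finite dimension
into the finiteness needed for Hall's theorem. -/
theorem finite_setOf_mem {a : P} (h : FiniteDimensional k ((intervalSum k J).obj a)) :
    {i | a ∈ (J i).carrier}.Finite := by
  classical
  have hli : LinearIndependent k fun i : {i | a ∈ (J i).carrier} => gen k J i.1 a := by
    rw [linearIndependent_iff']
    intro s g hg i hi
    have h0 := congrArg (coeff J i.1 a) hg
    simp only [map_sum, map_smul, coeff_gen, smul_eq_mul, map_zero] at h0
    rw [Finset.sum_eq_single_of_mem i hi] at h0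
    · simpa [show a ∈ (J i.1).carrier from i.2] using h0
    · intro j _ hj
      simp [Subtype.coe_injective.ne hj]
  exact hli.finite

end IntervalSum

/-! Summands of free modules. -/

section Summand

variable {k : Type u} [Field k] {P : Type} [PartialOrder P] {ι κ : Type u}

/-- Principal intervals are up-sets, so no coordinate dies along an internal map. -/
theorem coeff_map_principal (ξ : ι → P) {a b : P} (f : a ⟶ b) (i : ι)
    (x : (intervalSum k fun i => principal (ξ i)).obj a) :
    coeff (fun i => principal (ξ i)) i b ((intervalSum k fun i => principal (ξ i)).map f x) =
      coeff (fun i => principal (ξ i)) i a x := by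
  classical
  rw [coeff_map]
  by_cases ha : a ∈ (principal (ξ i)).carrier
  · rw [if_pos ⟨ha, le_trans (b := a) ha (leOfHom f)⟩]
  · rw [if_neg fun h => ha h.1, coeff_eq_zero (fun i => principal (ξ i)) ha]

/-- An interval module that occurs in an interval decomposition of a free module is free. -/
theorem exists_eq_principal (J : κ → Interval P) (ξ : ι → P)
    (e : intervalSum k J ≅ intervalSum k fun i => principal (ξ i)) (j : κ) :
    ∃ a, J j = principal a := by
  classical
  set Q : ι → Interval P := fun i => principal (ξ i) with hQ
  obtain ⟨p, hp⟩ := (J j).nonempty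
  have nat {a b : P} (f : a ⟶ b) (x : (intervalSum k J).obj a) :
      e.hom.app b ((intervalSum k J).map f x) = (intervalSum k Q).map f (e.hom.app a x) :=
    NatTrans.naturality_apply e.hom f x
  have nat' {a b : P} (f : a ⟶ b) (x : (intervalSum k Q).obj a) :
      e.inv.app b ((intervalSum k Q).map f x) = (intervalSum k J).map f (e.inv.app a x) :=
    NatTrans.naturality_apply e.inv f x
  -- The `j`-th coordinate of `e.inv (e.hom gen)` is `1` and is a sum over `i` of products of these
  -- two scalars, so some product is nonzero.
  obtain ⟨i, hi, hi'⟩ : ∃ i, coeff Q i p (e.hom.app p (gen k J j p)) ≠ 0 ∧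
      coeff J j p (e.inv.app p (gen k Q i p)) ≠ 0 := by
    by_contra! H
    have h1 : coeff J j p (e.inv.app p (e.hom.app p (gen k J j p))) = 1 := by
      rw [← ModuleCat.comp_apply, Iso.hom_inv_id_app]
      exact coeff_gen_self J hp
    have hs := finite_coeff_ne_zero Q (e.hom.app p (gen k J j p))
    rw [eq_sum_coeff_smul_gen Q (e.hom.app p (gen k J j p)) (s := hs.toFinset) (by simp)] at h1
    simp only [map_sum, map_smul, smul_eq_mul] at h1
    rw [Finset.sum_eq_zero] at h1
    · exact zero_ne_one h1
    · intro i _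
      by_cases h : coeff Q i p (e.hom.app p (gen k J j p)) = 0
      · rw [h, zero_mul]
      · rw [H i h, mul_zero]
  have hξp : ξ i ≤ p := mem_of_coeff_ne_zero Q hi
  -- The generator at `p` comes from `ξ i`, so the `j`-th coordinate must survive the internal map
  -- from `ξ i` to `p`.
  have hξ : ξ i ∈ (J j).carrier := by
    rw [← map_gen Q (homOfLE hξp) (i := i) (le_refl (ξ i)), nat', coeff_map] at hi'
    by_contra h
    exact hi' (if_neg fun h' => h h'.1)
  have hle {a b : P} (hab : a ≤ b) (ha : a ∈ (J j).carrier) :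
      coeff Q i b (e.hom.app b (gen k J j b)) = coeff Q i a (e.hom.app a (gen k J j a)) := by
    rw [← map_gen J (homOfLE hab) ha, nat]
    exact coeff_map_principal ξ _ _ _
  -- The `i`-th coordinate is constant along comparable points of `J j`, hence nonzero on all of it
  -- by connectedness.
  have hconst {q : P} (hq : q ∈ (J j).carrier) :
      coeff Q i q (e.hom.app q (gen k J j q)) ≠ 0 := by
    induction (J j).connected p hp q hq with
    | refl => exact hi
    | tail _ h ih =>
      have ih := ih h.1
      obtain ⟨ha, hb, h | h⟩ := h
      · rwa [hle h ha]
      · rwa [← hle h hb]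
  refine ⟨ξ i, ?_⟩
  have hcar : (J j).carrier = (principal (ξ i)).carrier := by
    ext q
    refine ⟨fun hq => mem_of_coeff_ne_zero Q (hconst hq), fun hq => ?_⟩
    by_contra h
    have h0 : gen k J j q = 0 := coeff_ext J fun l => by
      rw [coeff_gen, if_neg fun h' => h h'.2, map_zero]
    have h1 := hle (show ξ i ≤ q from hq) hξ
    rw [h0, map_zero, map_zero] at h1
    exact hconst hξ h1.symm
  cases hJ : J j
  rw [hJ] at hcar
  cases hcar
  rfl

end Summand

/-! ### Distinct representatives from a one-sided matrix inverse. -/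

section Hall

variable {k : Type*} [Field k] {α β : Type*}

/-- If a matrix over `F` with `G F = 1` has, in each entry `(c, a)` with `r a ≤ r c`, only
contributions from indices related to `a` or to `c`, then there is a system of distinct
representatives for the relation. -/
theorem exists_injective_rel_of_mul_eq_one (F : β → α → k) (G : α → β → k)
    (h1 : ∀ c, ∑ᶠ b, F b c * G c b = 1)
    (h0 : ∀ c a, c ≠ a → ∑ᶠ b, F b a * G c b = 0)
    (R : α → β → Prop) (hR : ∀ a, {b | R a b}.Finite) (r : α → ℝ)
    (hr : ∀ a b c, r a ≤ r c → F b a ≠ 0 → G c b ≠ 0 → R a b ∨ R c b) :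
    ∃ m : α → β, Function.Injective m ∧ ∀ a, R a (m a) := by
  classical
  have key := (Finset.all_card_le_biUnion_card_iff_exists_injective
    fun a => (hR a).toFinset).1 ?_
  · obtain ⟨m, hm, h⟩ := key
    exact ⟨m, hm, fun a => by simpa using h a⟩
  intro s
  set t := s.biUnion fun a => (hR a).toFinset with ht
  have hmul {a c : α} (ha : a ∈ s) (hc : c ∈ s) (hac : r a ≤ r c) :
      ∑ b ∈ t, F b a * G c b = if c = a then 1 else 0 := by
    rw [← finsum_eq_sum_of_support_subset]
    · split_ifs with h
      · rw [← h, h1]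
      · exact h0 c a h
    · intro b hb
      have hb : F b a * G c b ≠ 0 := hb
      rw [Finset.mem_coe, ht, Finset.mem_biUnion]
      rcases hr a b c hac (left_ne_zero_of_mul hb) (right_ne_zero_of_mul hb) with h | h
      · exact ⟨a, ha, by simpa using h⟩
      · exact ⟨c, hc, by simpa using h⟩
  let L : (s → k) →ₗ[k] (t → k) :=
    Matrix.mulVecLin (Matrix.of fun (b : t) (a : s) => F b a)
  have hL : Function.Injective L := by
    rw [injective_iff_map_eq_zero]
    intro v hv
    by_contra hne
    obtain ⟨c₀, hc₀⟩ := Function.ne_iff.1 hne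
    -- With `r c` maximal on the support of `v`, row `c` of the product only meets columns where the
    -- sum over `t` is the full identity entry. It returns `v c`, yet `F v = 0`.
    obtain ⟨c, hc, hmax⟩ := Finset.exists_max_image
      (Finset.univ.filter fun a : s => v a ≠ 0) (fun a => r a) ⟨c₀, by simpa using hc₀⟩
    have hvc : v c ≠ 0 := by simpa using hc
    apply hvc
    calc v c = ∑ a : s, (∑ b : t, F b a * G c b) * v a := by
          rw [Finset.sum_eq_single c]
          · rw [Finset.sum_coe_sort t fun b => F b c * G c b, hmul c.2 c.2 le_rfl]
            simp
          · intro a _ hac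
            by_cases hva : v a = 0
            · rw [hva, mul_zero]
            · rw [Finset.sum_coe_sort t fun b => F b a * G c b,
                hmul a.2 c.2 (hmax a (by simpa using hva)),
                if_neg (Subtype.coe_injective.ne hac.symm), zero_mul]
          · simp
      _ = ∑ b : t, (∑ a : s, F b a * v a) * G c b := by
          simp_rw [Finset.sum_mul]
          rw [Finset.sum_comm]
          exact Finset.sum_congr rfl fun b _ => Finset.sum_congr rfl fun a _ => by ring
      _ = 0 := by
          refine Finset.sum_eq_zero fun b _ => ?_
          have : ∑ a : s, F b a * v a = 0 := congrFun hv b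
          rw [this, zero_mul]
  simpa using LinearMap.finrank_le_finrank_of_injective hL

end Hall

/-! ### Closeness of points in the plane. -/

section Plane

/-- Two points of the plane are `ε`-close in the maximum metric. -/
def Close (ε : ℝ≥0) (a b : Plane) : Prop :=
  a ≤ translate ε b ∧ b ≤ translate ε a

/-- If both fail, `a > b + ε` in one coordinate and `b > c + ε` in one coordinate. If these differ,
`a > c` in both. If they agree, `a` exceeds `c` there by more than `2ε`, while `c` exceeds `a` in
the other by at most `2ε`. Either way `a` has the larger sum. -/
theorem close_or_close {ε : ℝ≥0} {a b c : Plane} (hba : b ≤ translate ε a)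
    (hcb : c ≤ translate ε b) (hr : a.x + a.y ≤ c.x + c.y) : Close ε a b ∨ Close ε c b := by
  obtain ⟨h1, h2⟩ := hba
  obtain ⟨h3, h4⟩ := hcb
  by_contra! h
  obtain ⟨hab, hcb'⟩ := h
  have hab : ¬ a ≤ translate ε b := fun h => hab ⟨h, h1, h2⟩
  have hbc : ¬ b ≤ translate ε c := fun h => hcb' ⟨⟨h3, h4⟩, h⟩
  simp only [translate] at h1 h2 h3 h4
  have hab : ¬ (a.x ≤ b.x + ε ∧ a.y ≤ b.y + ε) := hab
  have hbc : ¬ (b.x ≤ c.x + ε ∧ b.y ≤ c.y + ε) := hbc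
  rw [not_and_or, not_le, not_le] at hab hbc
  rcases hab with hab | hab <;> rcases hbc with hbc | hbc <;> linarith

end Plane

/-! ### From interleavings to injections of generators. -/

section Forward

variable {k : Type u} [Field k] {α β : Type u}

/-- The entry at `(b, a)` of the matrix of a morphism from a free module to a shifted free
module. -/
def entry {ε : ℝ≥0} {ξ : α → Plane} {η : β → Plane}
    (f : intervalSum k (fun i => principal (ξ i)) ⟶
      shift ε (intervalSum k fun j => principal (η j))) (b : β) (a : α) : k :=
  coeff (fun j => principal (η j)) b (translate ε (ξ a))
    (f.app (ξ a) (gen k (fun i => principal (ξ i)) a (ξ a)))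

variable {ε : ℝ≥0} {ξ : α → Plane} {η : β → Plane}
  (f : intervalSum k (fun i => principal (ξ i)) ⟶
    shift ε (intervalSum k fun j => principal (η j)))
  (g : intervalSum k (fun j => principal (η j)) ⟶
    shift ε (intervalSum k fun i => principal (ξ i)))

theorem le_of_entry_ne_zero {b : β} {a : α} (h : entry f b a ≠ 0) : η b ≤ translate ε (ξ a) :=
  mem_of_coeff_ne_zero (fun j => principal (η j)) h

theorem finite_entry_ne_zero (a : α) : {b | entry f b a ≠ 0}.Finite :=
  finite_coeff_ne_zero (fun j => principal (η j)) _

/-- Needed because composing applies the second morphism to generators at translated points, not at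
their births. -/
theorem coeff_app_gen {a : α} {p : Plane} (h : ξ a ≤ p) (b : β) :
    coeff (fun j => principal (η j)) b (translate ε p)
      (f.app p (gen k (fun i => principal (ξ i)) a p)) = entry f b a := by
  rw [← map_gen (fun i => principal (ξ i)) (homOfLE h) (i := a) (le_refl (ξ a)),
    NatTrans.naturality_apply f]
  exact coeff_map_principal η ((translate_mono ε).functor.map (homOfLE h)) b _

theorem finsum_entry_mul_entry (c a : α) :
    ∑ᶠ b, entry f b a * entry g c b =
      coeff (fun i => principal (ξ i)) c (translate ε (translate ε (ξ a)))
        (g.app (translate ε (ξ a)) (f.app (ξ a) (gen k (fun i => principal (ξ i)) a (ξ a)))) := by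
  classical
  set x : (intervalSum k fun j => principal (η j)).obj (translate ε (ξ a)) :=
    f.app (ξ a) (gen k (fun i => principal (ξ i)) a (ξ a)) with hx
  have hs := eq_sum_coeff_smul_gen (fun j => principal (η j)) x
    (s := (finite_entry_ne_zero f a).toFinset) (fun i hi => by simpa [entry] using hi)
  rw [finsum_eq_sum_of_support_subset (s := (finite_entry_ne_zero f a).toFinset)]
  · conv_rhs => rw [hs]
    erw [map_sum, map_sum]
    refine Finset.sum_congr rfl fun b hb => ?_
    erw [map_smul, map_smul]
    rw [coeff_app_gen g (le_of_entry_ne_zero f (by simpa using hb))]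
    rfl
  · intro b hb
    simpa using left_ne_zero_of_mul hb

open Classical in
theorem finsum_entry_mul_entry_eq
    (h : ∀ a, f.app a ≫ g.app (translate ε a) = (intervalSum k fun i => principal (ξ i)).map
      (homOfLE ((le_translate ε a).trans (le_translate ε (translate ε a))))) (c a : α) :
    ∑ᶠ b, entry f b a * entry g c b = if c = a then 1 else 0 := by
  rw [finsum_entry_mul_entry]
  have h' := congrArg (coeff (fun i => principal (ξ i)) c (translate ε (translate ε (ξ a))))
    (ConcreteCategory.congr_hom (h (ξ a)) (gen k (fun i => principal (ξ i)) a (ξ a)))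
  refine h'.trans ((coeff_map_principal ξ _ _ _).trans ?_)
  rw [coeff_gen]
  have : ξ a ∈ (principal (ξ a)).carrier := le_refl (ξ a)
  simp [this, eq_comm]

theorem exists_injective_close
    (h : ∀ a, f.app a ≫ g.app (translate ε a) = (intervalSum k fun i => principal (ξ i)).map
      (homOfLE ((le_translate ε a).trans (le_translate ε (translate ε a)))))
    (hN : IsPFD (intervalSum k fun j => principal (η j))) :
    ∃ m : α → β, Function.Injective m ∧ ∀ a, Close ε (ξ a) (η (m a)) := by
  classical
  refine exists_injective_rel_of_mul_eq_one (entry f) (entry g)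
    (fun c => by rw [finsum_entry_mul_entry_eq f g h, if_pos rfl])
    (fun c a hca => by rw [finsum_entry_mul_entry_eq f g h, if_neg hca])
    (fun a b => Close ε (ξ a) (η b)) (fun a => ?_) (fun a => (ξ a).x + (ξ a).y)
    (fun a b c hac hf hg => close_or_close (le_of_entry_ne_zero f hf) (le_of_entry_ne_zero g hg)
      hac)
  exact (finite_setOf_mem (fun j => principal (η j)) (hN (translate ε (ξ a)))).subset
    fun b hb => hb.2

end Forward

/-! ### From matchings to interleavings, and the equivalence. -/

section Interleavings

variable {k : Type u} [Field k] {α β : Type u}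

theorem IsInterleaved.of_iso {C : Type*} [Category C] {ε : ℝ≥0} {M M' N N' : Plane ⥤ C}
    (e : M ≅ M') (e' : N ≅ N') (h : IsInterleaved ε M N) : IsInterleaved ε M' N' := by
  obtain ⟨f, g, hf, hg⟩ := h
  have conj {A A' X X' Y Y' : C} (r : A' ⟶ A) (f : A ⟶ X) (u : X ⟶ X') (v : X' ⟶ X) (g : X ⟶ Y)
      (w : Y ⟶ Y') (huv : u ≫ v = 𝟙 X) : (r ≫ f ≫ u) ≫ v ≫ g ≫ w = r ≫ (f ≫ g) ≫ w := by
    simp only [Category.assoc]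
    rw [reassoc_of% huv]
  have nat {M M' : Plane ⥤ C} (e : M ≅ M') {a b : Plane} (h : a ⟶ b) :
      e.inv.app a ≫ M.map h ≫ e.hom.app b = M'.map h := by
    rw [e.hom.naturality, Iso.inv_hom_id_app_assoc]
  refine ⟨e.inv ≫ f ≫ Functor.whiskerLeft _ e'.hom, e'.inv ≫ g ≫ Functor.whiskerLeft _ e.hom,
    fun a => ?_, fun a => ?_⟩
  · refine (conj (e.inv.app a) (f.app a) (e'.hom.app (translate ε a)) (e'.inv.app (translate ε a))
      (g.app (translate ε a)) (e.hom.app (translate ε (translate ε a)))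
      (Iso.hom_inv_id_app e' _)).trans ?_
    exact (congrArg (fun t => e.inv.app a ≫ t ≫ e.hom.app (translate ε (translate ε a)))
      (hf a)).trans (nat e _)
  · refine (conj (e'.inv.app a) (g.app a) (e.hom.app (translate ε a)) (e.inv.app (translate ε a))
      (f.app (translate ε a)) (e'.hom.app (translate ε (translate ε a)))
      (Iso.hom_inv_id_app e _)).trans ?_
    exact (congrArg (fun t => e'.inv.app a ≫ t ≫ e'.hom.app (translate ε (translate ε a)))
      (hg a)).trans (nat e' _)

theorem isInterleaved_congr {C : Type*} [Category C] {ε : ℝ≥0} {M M' N N' : Plane ⥤ C}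
    (e : M ≅ M') (e' : N ≅ N') : IsInterleaved ε M N ↔ IsInterleaved ε M' N' :=
  ⟨IsInterleaved.of_iso e e', IsInterleaved.of_iso e.symm e'.symm⟩

/-- The inclusion of a principal interval module into the shift of another one. -/
def principalHom (k : Type u) [Field k] {ε : ℝ≥0} {a b : Plane} (h : b ≤ translate ε a) :
    intervalModule k (principal a) ⟶ shift ε (intervalModule k (principal b)) where
  app p := ModuleCat.ofHom (X := intervalSpace k (principal a) p)
    (Y := intervalSpace k (principal b) (translate ε p))
    (Submodule.inclusion fun _ hx hp => hx fun hap => hp (h.trans (translate_mono ε hap)))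
  naturality p q hpq := by
    ext1
    refine LinearMap.ext fun x => Subtype.ext ?_
    classical
    change (if p ∈ (principal a).carrier ∧ q ∈ (principal a).carrier then x.1 else 0) =
      (if translate ε p ∈ (principal b).carrier ∧ translate ε q ∈ (principal b).carrier
        then x.1 else 0)
    by_cases hp : p ∈ (principal a).carrier
    · have hq : q ∈ (principal a).carrier := le_trans (b := p) hp (leOfHom hpq)
      rw [if_pos ⟨hp, hq⟩, if_pos ⟨h.trans (translate_mono ε hp), h.trans (translate_mono ε hq)⟩]
    · have hx : x.1 = 0 := x.2 hp
      simp [hx]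

theorem principalHom_comp {ε : ℝ≥0} {a b : Plane} (h : b ≤ translate ε a)
    (h' : a ≤ translate ε b) (p : Plane) :
    (principalHom k h).app p ≫ (principalHom k h').app (translate ε p) =
      (intervalModule k (principal a)).map
        (homOfLE ((le_translate ε p).trans (le_translate ε (translate ε p)))) := by
  classical
  ext1
  refine LinearMap.ext fun x => Subtype.ext ?_
  change x.1 = (if p ∈ (principal a).carrier ∧
    translate ε (translate ε p) ∈ (principal a).carrier then x.1 else 0)
  by_cases hp : p ∈ (principal a).carrier
  · rw [if_pos ⟨hp, le_trans (b := p) hp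
      ((le_translate ε p).trans (le_translate ε (translate ε p)))⟩]
  · have hx : x.1 = 0 := x.2 hp
    simp [hx]

theorem Close.isInterleaved {ε : ℝ≥0} {a b : Plane} (h : Close ε a b) :
    IsInterleaved ε (intervalModule k (principal a)) (intervalModule k (principal b)) :=
  ⟨principalHom k h.2, principalHom k h.1, principalHom_comp h.2 h.1, principalHom_comp h.1 h.2⟩

theorem not_isTrivial_principal (ε : ℝ≥0) (a : Plane) :
    ¬ IsTrivial ε (intervalModule k (principal a)) := by
  classical
  intro h
  have h0 := congrArg Subtype.val (ConcreteCategory.congr_hom (h a)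
    (⟨1, fun h => absurd (le_refl a) h⟩ : intervalSpace k (principal a) a))
  have h1 : (if a ∈ (principal a).carrier ∧ translate ε a ∈ (principal a).carrier
    then (1 : k) else 0) = 0 := h0
  rw [if_pos ⟨le_refl a, le_translate ε a⟩] at h1
  exact one_ne_zero h1

/-- The morphism of direct sums given by morphisms between the summands. -/
def directSumHom {ε : ℝ≥0} {M N : α → PersMod k Plane} (f : ∀ i, M i ⟶ shift ε (N i)) :
    directSum M ⟶ shift ε (directSum N) where
  app p := ModuleCat.ofHom (X := ⨁ i, (M i).obj p) (Y := ⨁ i, (N i).obj (translate ε p))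
    (DirectSum.lmap fun i => ((f i).app p).hom)
  naturality p q hpq := by
    ext1
    refine LinearMap.ext fun x => DirectSum.ext_component k fun i => ?_
    exact NatTrans.naturality_apply (f i) hpq (DirectSum.component k α (fun i => (M i).obj p) i x)

theorem directSumHom_comp {ε : ℝ≥0} {M N : α → PersMod k Plane}
    (f : ∀ i, M i ⟶ shift ε (N i)) (g : ∀ i, N i ⟶ shift ε (M i))
    (h : ∀ i a, (f i).app a ≫ (g i).app (translate ε a) =
      (M i).map (homOfLE ((le_translate ε a).trans (le_translate ε (translate ε a)))))
    (a : Plane) : (directSumHom f).app a ≫ (directSumHom g).app (translate ε a) =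
      (directSum M).map (homOfLE ((le_translate ε a).trans (le_translate ε (translate ε a)))) := by
  ext1
  refine LinearMap.ext fun x => DirectSum.ext_component k fun i => ?_
  exact ConcreteCategory.congr_hom (h i a) (DirectSum.component k α (fun i => (M i).obj a) i x)

/-- Direct sums can be reindexed. -/
def directSumReindex (e : α ≃ β) (M : α → PersMod k Plane) :
    directSum M ≅ directSum fun j => M (e.symm j) :=
  NatIso.ofComponents
    (fun p => (DirectSum.lequivCongrLeft k (M := fun i => (M i).obj p) e).toModuleIso) (by
      intro p q hpq
      ext1
      exact LinearMap.ext fun x => DirectSum.ext_component k fun i => rfl)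

theorem isInterleaved_directSum {ε : ℝ≥0} {M : α → PersMod k Plane} {N : β → PersMod k Plane}
    (e : α ≃ β) (h : ∀ i, IsInterleaved ε (M i) (N (e i))) :
    IsInterleaved ε (directSum M) (directSum N) := by
  have h' : ∀ j, IsInterleaved ε (M (e.symm j)) (N j) := fun j => by
    simpa using h (e.symm j)
  choose f g hf hg using h'
  exact IsInterleaved.of_iso (directSumReindex e M).symm (Iso.refl _)
    ⟨directSumHom f, directSumHom g, directSumHom_comp f g hf, directSumHom_comp g f hg⟩

theorem IsPFD.of_iso {M N : PersMod k Plane} (e : M ≅ N) (h : IsPFD M) : IsPFD N := fun a =>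
  haveI := h a
  Module.Finite.equiv (e.app a).toLinearEquiv

/-- An interval decomposition of a free module consists of principal intervals. -/
theorem IsFree.exists_eq_principal {M : PersMod k Plane} (hM : IsFree M) {C : Barcode.{u} Plane}
    (hC : IsBarcode M C) : ∃ ξ : C.ι → Plane, C.interval = fun i => principal (ξ i) := by
  obtain ⟨ι, ξ, ⟨e⟩⟩ := hM
  obtain ⟨e'⟩ := hC
  choose ξ' h using Persistence.exists_eq_principal C.interval ξ (e'.symm ≪≫ e)
  exact ⟨ξ', funext h⟩

theorem isInterleaved_free_iff {ε : ℝ≥0} {ξ : α → Plane} {η : β → Plane}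
    (hM : IsPFD (intervalSum k fun i => principal (ξ i)))
    (hN : IsPFD (intervalSum k fun j => principal (η j))) :
    IsInterleaved ε (intervalSum k fun i => principal (ξ i))
        (intervalSum k fun j => principal (η j)) ↔
      ∃ σ : α ≃. β, IsMatching k ε ⟨α, fun i => principal (ξ i)⟩ ⟨β, fun j => principal (η j)⟩ σ := by
  constructor
  · rintro ⟨f, g, hf, hg⟩
    obtain ⟨m, hm, hm'⟩ := exists_injective_close f g hf hN
    obtain ⟨n, hn, hn'⟩ := exists_injective_close g f hg hM
    -- The index sets may be infinite, so two injections need merging; each pair of the bijection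
    -- comes from `m` or from `n`, hence is close.
    obtain ⟨σ, hσ, hσ'⟩ := Function.Embedding.schroeder_bernstein_of_rel hm hn
      (fun i j => Close ε (ξ i) (η j)) hm' fun j => ⟨(hn' j).2, (hn' j).1⟩
    let e := Equiv.ofBijective σ hσ
    refine ⟨e.toPEquiv, fun i _ => ⟨σ i, by simp [e]⟩, fun j _ => ⟨e.symm j, by simp⟩, ?_⟩
    intro i j hij
    have hij : σ i = j := by simpa [e] using hij
    subst hij
    exact (hσ' i).isInterleaved
  · rintro ⟨σ, h1, h2, h3⟩
    -- No principal module is trivial, so the partial bijection is total on both sides.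
    choose m hm using fun i => h1 i (not_isTrivial_principal _ _)
    choose n hn using fun j => h2 j (not_isTrivial_principal _ _)
    have hmn (j : β) : m (n j) = j := Option.mem_unique (hm _) (hn j)
    have hnm (i : α) : n (m i) = i := σ.inj (hn _) (hm i)
    exact isInterleaved_directSum ⟨m, n, hnm, hmn⟩ fun i => h3 i (m i) (hm i)

end Interleavings

end Persistence

end

theorem mainTheorem5 {k : Type u} [Field k]
    (M N : Persistence.PersMod k Persistence.Plane)
    (hM : Persistence.IsPFD M) (hN : Persistence.IsPFD N)
    (hMfree : Persistence.IsFree M) (hNfree : Persistence.IsFree N)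
    (C D : Persistence.Barcode.{u} Persistence.Plane)
    (hC : Persistence.IsBarcode M C) (hD : Persistence.IsBarcode N D) :
    (∀ ε : NNReal, Persistence.IsInterleaved ε M N ↔
      ∃ σ : C.ι ≃. D.ι, Persistence.IsMatching k ε C D σ) ∧
    Persistence.interleavingDist M N = Persistence.bottleneckDist k C D := by
  have key : ∀ ε : NNReal, Persistence.IsInterleaved ε M N ↔
      ∃ σ : C.ι ≃. D.ι, Persistence.IsMatching k ε C D σ := by
    intro ε
    obtain ⟨α, J⟩ := C
    obtain ⟨β, K⟩ := D
    obtain ⟨ξ, rfl⟩ : ∃ ξ : α → _, J = fun i => Persistence.principal (ξ i) :=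
      hMfree.exists_eq_principal hC
    obtain ⟨η, rfl⟩ : ∃ η : β → _, K = fun j => Persistence.principal (η j) :=
      hNfree.exists_eq_principal hD
    obtain ⟨e⟩ := hC
    obtain ⟨e'⟩ := hD
    exact (Persistence.isInterleaved_congr e e').trans
      (Persistence.isInterleaved_free_iff (hM.of_iso e) (hN.of_iso e'))
  refine ⟨key, ?_⟩
  simp only [Persistence.interleavingDist, Persistence.bottleneckDist, key]
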